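/- Theorem. For $n \ge d \ge 1$ let $\mathcal H_{\mathsf{mon}}$ be the class of multilinear monomials $x_S = \prod_{i\in S} x_i$, $S \subseteq [n]$, $|S| \le d$, on $\mathbb R^n$. Let $B \ge 1$. A statistical query (SQ) learner makes adaptive queries $\phi : \mathbb R^n\times\mathbb R \to [-1,1]$ (measurable) to an unknown distribution $\mathcal D$ on $\mathbb R^n\times\mathbb R$; each query of tolerance $\tau$ is answered by an arbitrary value in $[\mathbb E_{\mathcal D}\phi - \tau, \mathbb E_{\mathcal D}\phi + \tau]$. Say that the learner agnostically learns $\mathcal H_{\mathsf{mon}}$ with error $\epsilon$ using $q$ queries of tolerance $\tau$ if, for every $\mathcal D$ whose marginal on $\mathbb R^n$ is $\mathcal N(0,I_n)$ and whose labels satisfy $|y|\le B$, it stops after at most $q$ queries, whatever the admissible answers, and outputs $f \in L^2(\mathcal N(0,I_n))$ with $\|f\|_{L^2} \le 1$ and \[ \mathbb E_{(x,y)\sim\mathcal D}[f(x)y] \ \ge\ \max_{h\in\mathcal H_{\mathsf{mon}}} \mathbb E_{(x,y)\sim\mathcal D}[h(x)y] - \epsilon . \] There is an absolute constant $C > 0$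 such that for all $1 \le d \le n$, all $0 < \epsilon \le \exp(-Cd)$, all $0 < \tau \le \epsilon^2$ and all $B \ge 1$, every SQ learner that agnostically learns $\mathcal H_{\mathsf{mon}}$ with error $\epsilon$ using $q$ queries of tolerance $\tau$ satisfies \[ q \ \ge\ \binom nd\, \tau^{5/2}. \] In particular $q \ge n^{\Omega(d)}\tau^{5/2}$ when $d \le n^{1-\Omega(1)}$: for every $\delta>0$, if $d \le n^{1-\delta}$ then $q \ge n^{\delta d}\,\tau^{5/2}$. -/

import Mathlib

open MeasureTheory ProbabilityTheory

noncomputable section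

namespace SQ

/-- The standard Gaussian distribution `N(0, I_n)` on `ℝⁿ`. -/
def gaussian (n : ℕ) : Measure (Fin n → ℝ) :=
  Measure.pi fun _ => gaussianReal 0 1

/-- The class of multilinear monomials `x_S = ∏_{i ∈ S} x_i` of degree `|S| ≤ d` on `ℝⁿ`. -/
def monomials (n d : ℕ) : Set ((Fin n → ℝ) → ℝ) :=
  {h | ∃ S : Finset (Fin n), S.card ≤ d ∧ h = fun x => ∏ i ∈ S, x i}

/-- `D` is a labeled distribution on `ℝⁿ × ℝ` with marginal `N(0, I_n)` on `ℝⁿ` and with labels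
bounded by `B` in absolute value. -/
structure IsLabeledDistribution {n : ℕ} (B : ℝ) (D : Measure ((Fin n → ℝ) × ℝ)) : Prop where
  marginal : D.map Prod.fst = gaussian n
  label_bound : ∀ᵐ p ∂D, |p.2| ≤ B

/-- A statistical query: a measurable function `φ : ℝⁿ × ℝ → [-1, 1]`. -/
structure StatQuery (n : ℕ) where
  toFun : (Fin n → ℝ) × ℝ → ℝ
  measurable : Measurable toFun
  bounded : ∀ p, toFun p ∈ Set.Icc (-1 : ℝ) 1

/-- An adaptive statistical query algorithm: it either stops and outputs a hypothesis
`f : ℝⁿ → ℝ`, or asks a query and continues depending on the real number it gets as answer. -/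
inductive Algorithm (n : ℕ) : Type
  | output (f : (Fin n → ℝ) → ℝ) : Algorithm n
  | ask (φ : StatQuery n) (next : ℝ → Algorithm n) : Algorithm n

/-- `Run D τ A k f`: when every query is answered by some value within the tolerance `τ` of its
expectation under `D`, it can happen that `A` stops after exactly `k` queries with output `f`. -/
inductive Run {n : ℕ} (D : Measure ((Fin n → ℝ) × ℝ)) (τ : ℝ) :
    Algorithm n → ℕ → ((Fin n → ℝ) → ℝ) → Prop
  | output (f : (Fin n → ℝ) → ℝ) : Run D τ (Algorithm.output f) 0 f
  | ask (φ : StatQuery n) (next : ℝ → Algorithm n) (v : ℝ) (k : ℕ) (f : (Fin n → ℝ) → ℝ)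
      (hv : |v - ∫ p, φ.toFun p ∂D| ≤ τ) (hrun : Run D τ (next v) k f) :
      Run D τ (Algorithm.ask φ next) (k + 1) f

/-- `A` agnostically learns the class `H` with error `ε` using at most `q` queries of tolerance
`τ`: for every labeled distribution `D` with Gaussian marginal and labels in `[-B, B]`, and however
the oracle answers within the tolerance, `A` makes at most `q` queries and outputs
`f ∈ L²(N(0, I_n))` of norm at most `R` with `E[f(x) y] ≥ E[h(x) y] - ε` for all `h ∈ H`. -/
def AgnosticallyLearns {n : ℕ} (A : Algorithm n) (H : Set ((Fin n → ℝ) → ℝ))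
    (R B ε τ : ℝ) (q : ℕ) : Prop :=
  ∀ D : Measure ((Fin n → ℝ) × ℝ), IsLabeledDistribution B D →
    ∀ (k : ℕ) (f : (Fin n → ℝ) → ℝ), Run D τ A k f →
      k ≤ q ∧ MemLp f 2 (gaussian n) ∧ eLpNorm f 2 (gaussian n) ≤ ENNReal.ofReal R ∧
        ∀ h ∈ H, ∫ p, h p.1 * p.2 ∂D - ε ≤ ∫ p, f p.1 * p.2 ∂D

end SQ

end

open MeasureTheory ProbabilityTheory

noncomputable section

namespace SQ

/-! The hard labels are `± parity S` with `|S| = d`. Parities are orthonormal under the Gaussian, so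
by Bessel a query distinguishes at most `1 / τ ^ 2` of them from uniformly random signs
(`card_correlated_parity_mul_sq_le`). If every query is answered as for random signs, a run of `k`
queries therefore stays admissible for both `parity S` and `-parity S`, outside at most `k / τ ^ 2`
sets `S` (`exists_run_forall_notMem`).

For a surviving `S` a single output `f` must serve both signs. Competing with `x_S` forces its
correlation with `parity S` up to `m ^ d - ε`, where `m = E|t|`; competing with the constant
monomial under the opposite labels keeps it at most `ε` (`pow_card_le_two_mul_error`). This is
impossible when `2 * ε < m ^ d`, so no `d`-set survives and `n.choose d * τ ^ 2 ≤ q`. -/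

instance isProbabilityMeasure_gaussian (n : ℕ) : IsProbabilityMeasure (gaussian n) := by
  unfold gaussian; infer_instance

/-! ### Signs and parities of Gaussian coordinates -/

/-- The sign of a real number, with value `1` at `0`. -/
def sgn (t : ℝ) : ℝ := if 0 ≤ t then 1 else -1

lemma measurable_sgn : Measurable sgn :=
  Measurable.ite measurableSet_Ici measurable_const measurable_const

lemma sgn_eq_one_or (t : ℝ) : sgn t = 1 ∨ sgn t = -1 := by
  unfold sgn; split_ifs <;> simp

lemma mul_sgn (t : ℝ) : t * sgn t = |t| := by
  unfold sgn
  split_ifs with h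
  · rw [abs_of_nonneg h, mul_one]
  · rw [abs_of_neg (not_le.1 h), mul_neg_one]

lemma sgn_neg {t : ℝ} (ht : t ≠ 0) : sgn (-t) = -sgn t := by
  unfold sgn
  rcases ht.lt_or_gt with h | h
  · rw [if_pos (by linarith), if_neg (by linarith)]; norm_num
  · rw [if_neg (by linarith), if_pos h.le]

lemma integral_sgn_gaussianReal : ∫ t, sgn t ∂gaussianReal 0 1 = 0 := by
  have : NullSingletonClass (gaussianReal 0 1) := nullSingletonClass_gaussianReal one_ne_zero
  have hmap : (gaussianReal 0 1).map (fun t => -t) = gaussianReal 0 1 := by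
    rw [gaussianReal_map_neg, neg_zero]
  -- `sgn` is odd only away from `0`, which is a null set.
  have hne : ∀ᵐ t ∂gaussianReal 0 1, t ≠ 0 := by
    simp [ae_iff, measure_singleton]
  have h : ∫ t, sgn t ∂gaussianReal 0 1 = -∫ t, sgn t ∂gaussianReal 0 1 := by
    conv_lhs => rw [← hmap]
    rw [integral_map (by fun_prop) measurable_sgn.aestronglyMeasurable, ← integral_neg]
    exact integral_congr_ae (hne.mono fun t ht => sgn_neg ht)
  linarith

lemma integral_abs_gaussianReal_pos : 0 < ∫ t, |t| ∂gaussianReal 0 1 := by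
  have : NullSingletonClass (gaussianReal 0 1) := nullSingletonClass_gaussianReal one_ne_zero
  have hint : Integrable (fun t : ℝ => |t|) (gaussianReal 0 1) :=
    ((memLp_id_gaussianReal 1).integrable le_rfl).abs
  rw [integral_pos_iff_support_of_nonneg (fun t => abs_nonneg t) hint]
  have hsupp : Function.support (fun t : ℝ => |t|) = {0}ᶜ := by
    ext t; simp
  rw [hsupp, measure_compl (measurableSet_singleton 0) (measure_ne_top _ _)]
  simp [measure_singleton]

/-- The parity `∏_{i ∈ S} sgn (x_i)` of the signs of the coordinates in `S`. -/
def parity {n : ℕ} (S : Finset (Fin n)) (x : Fin n → ℝ) : ℝ := ∏ i ∈ S, sgn (x i)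

variable {n : ℕ}

lemma measurable_parity (S : Finset (Fin n)) : Measurable (parity S) :=
  Finset.measurable_prod _ fun i _ => measurable_sgn.comp (measurable_pi_apply i)

lemma measurable_neg_parity (S : Finset (Fin n)) : Measurable fun x => -parity S x :=
  (measurable_parity S).neg

lemma parity_eq_one_or (S : Finset (Fin n)) (x : Fin n → ℝ) : parity S x = 1 ∨ parity S x = -1 := by
  unfold parity
  induction S using Finset.induction_on with
  | empty => simp
  | insert a s ha ih =>
    rw [Finset.prod_insert ha]
    rcases sgn_eq_one_or (x a) with h | h <;> rcases ih with h' | h' <;> rw [h, h'] <;> norm_num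

lemma abs_parity (S : Finset (Fin n)) (x : Fin n → ℝ) : |parity S x| = 1 := by
  rcases parity_eq_one_or S x with h | h <;> rw [h] <;> norm_num

lemma integral_gaussian_prod (f : Fin n → ℝ → ℝ) :
    ∫ x, ∏ i, f i (x i) ∂gaussian n = ∏ i, ∫ t, f i t ∂gaussianReal 0 1 :=
  integral_fintype_prod_eq_prod f

/-- By independence the integral factors over coordinates; a coordinate in exactly one of the two
sets contributes the mean of `sgn`, which vanishes. -/
lemma integral_parity_mul_parity (S T : Finset (Fin n)) :
    ∫ x, parity S x * parity T x ∂gaussian n = if S = T then 1 else 0 := by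
  split_ifs with hST
  · subst hST
    have h : ∀ x, parity S x * parity S x = 1 := fun x => by
      rw [← abs_mul_abs_self, abs_parity, one_mul]
    simp [h]
  · have h : ∀ x : Fin n → ℝ, parity S x * parity T x =
        ∏ i, ((if i ∈ S then sgn (x i) else 1) * (if i ∈ T then sgn (x i) else 1)) := fun x => by
      rw [Finset.prod_mul_distrib]
      simp [parity]
    simp_rw [h]
    rw [integral_gaussian_prod
      (fun i t => (if i ∈ S then sgn t else 1) * (if i ∈ T then sgn t else 1))]
    obtain ⟨i, hi⟩ : ∃ i, ¬(i ∈ S ↔ i ∈ T) := by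
      by_contra! hc
      exact hST (Finset.ext hc)
    refine Finset.prod_eq_zero (Finset.mem_univ i) ?_
    by_cases hS : i ∈ S <;> by_cases hT : i ∈ T <;>
      simp_all [integral_sgn_gaussianReal]

lemma integral_parity_eq_zero {S : Finset (Fin n)} (hS : S.Nonempty) :
    ∫ x, parity S x ∂gaussian n = 0 := by
  have h := integral_parity_mul_parity S ∅
  rw [if_neg hS.ne_empty] at h
  simpa [parity] using h

lemma integral_monomial_mul_parity (S : Finset (Fin n)) :
    ∫ x, (∏ i ∈ S, x i) * parity S x ∂gaussian n = (∫ t, |t| ∂gaussianReal 0 1) ^ S.card := by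
  have h : ∀ x : Fin n → ℝ, (∏ i ∈ S, x i) * parity S x =
      ∏ i, (if i ∈ S then |x i| else 1) := fun x => by
    rw [parity, ← Finset.prod_mul_distrib]
    simp [mul_sgn]
  simp_rw [h]
  rw [integral_gaussian_prod (fun i t => if i ∈ S then |t| else 1)]
  have h' : ∀ i : Fin n, ∫ t, (if i ∈ S then |t| else 1) ∂gaussianReal 0 1 =
      if i ∈ S then ∫ t, |t| ∂gaussianReal 0 1 else 1 := fun i => by
    split_ifs <;> simp
  simp_rw [h']
  simp

/-! ### Bessel's inequality and correlated parities -/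

/-- Bessel's inequality for finite families of bounded orthonormal functions. -/
lemma sum_sq_integral_mul_le {Ω ι : Type*} [MeasurableSpace Ω] [DecidableEq ι] {μ : Measure Ω}
    [IsProbabilityMeasure μ] {e : ι → Ω → ℝ} {g : Ω → ℝ} (F : Finset ι)
    (he : ∀ i, MemLp (e i) 2 μ) (hg : MemLp g 2 μ)
    (horth : ∀ i j, ∫ x, e i x * e j x ∂μ = if i = j then 1 else 0) :
    ∑ i ∈ F, (∫ x, e i x * g x ∂μ) ^ 2 ≤ ∫ x, g x ^ 2 ∂μ := by
  set c : ι → ℝ := fun i => ∫ x, e i x * g x ∂μ with hc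
  have hgg : Integrable (fun x => g x ^ 2) μ := hg.integrable_sq
  have heg : ∀ i, Integrable (fun x => c i * (e i x * g x)) μ :=
    fun i => ((he i).integrable_mul hg).const_mul _
  have hee : ∀ i j, Integrable (fun x => c i * c j * (e i x * e j x)) μ :=
    fun i j => ((he i).integrable_mul (he j)).const_mul _
  -- The residual of the projection onto the span has nonnegative squared norm; expanding that norm
  -- gives the inequality.
  have hexp : ∀ x, (g x - ∑ i ∈ F, c i * e i x) ^ 2 = g x ^ 2
      - 2 * ∑ i ∈ F, c i * (e i x * g x) + ∑ i ∈ F, ∑ j ∈ F, c i * c j * (e i x * e j x) := by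
    intro x
    have h1 : ∑ i ∈ F, c i * (e i x * g x) = (∑ i ∈ F, c i * e i x) * g x := by
      rw [Finset.sum_mul]
      exact Finset.sum_congr rfl fun i _ => by ring
    have h2 : ∑ i ∈ F, ∑ j ∈ F, c i * c j * (e i x * e j x) = (∑ i ∈ F, c i * e i x) ^ 2 := by
      rw [sq, Finset.sum_mul_sum]
      exact Finset.sum_congr rfl fun i _ => Finset.sum_congr rfl fun j _ => by ring
    rw [h1, h2]; ring
  have hnn : 0 ≤ ∫ x, (g x - ∑ i ∈ F, c i * e i x) ^ 2 ∂μ :=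
    integral_nonneg fun x => sq_nonneg _
  simp_rw [hexp] at hnn
  have hI1 : Integrable (fun x => ∑ i ∈ F, c i * (e i x * g x)) μ :=
    integrable_finsetSum _ fun i _ => heg i
  have hI2 : Integrable (fun x => ∑ i ∈ F, ∑ j ∈ F, c i * c j * (e i x * e j x)) μ :=
    integrable_finsetSum _ fun i _ => integrable_finsetSum _ fun j _ => hee i j
  have hI3 : Integrable (fun x => g x ^ 2 - 2 * ∑ i ∈ F, c i * (e i x * g x)) μ :=
    hgg.sub (hI1.const_mul 2)
  rw [integral_add hI3 hI2, integral_sub hgg (hI1.const_mul 2),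
    integral_const_mul, integral_finsetSum _ (fun i _ => heg i),
    integral_finsetSum _ (fun i _ => integrable_finsetSum _ fun j _ => hee i j)] at hnn
  have hA : ∑ i ∈ F, ∫ x, c i * (e i x * g x) ∂μ = ∑ i ∈ F, c i ^ 2 :=
    Finset.sum_congr rfl fun i _ => by rw [integral_const_mul, sq]
  have hB : ∑ i ∈ F, ∫ x, ∑ j ∈ F, c i * c j * (e i x * e j x) ∂μ = ∑ i ∈ F, c i ^ 2 := by
    refine Finset.sum_congr rfl fun i hi => ?_
    rw [integral_finsetSum _ (fun j _ => hee i j)]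
    simp_rw [integral_const_mul, horth]
    simp [hi, sq]
  rw [hA, hB] at hnn
  linarith

lemma memLp_two_parity (S : Finset (Fin n)) : MemLp (parity S) 2 (gaussian n) :=
  MemLp.of_bound (measurable_parity S).aestronglyMeasurable 1
    (Filter.Eventually.of_forall fun x => by rw [Real.norm_eq_abs, abs_parity])

/-- A bounded function correlates by more than `τ` with at most `1 / τ ^ 2` parities. -/
lemma card_correlated_parity_mul_sq_le {g : (Fin n → ℝ) → ℝ} (hg : Measurable g)
    (hg1 : ∀ x, |g x| ≤ 1) {τ : ℝ} (hτ : 0 < τ) :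
    ((Finset.univ.filter fun S : Finset (Fin n) =>
      τ < |∫ x, parity S x * g x ∂gaussian n|).card : ℝ) * τ ^ 2 ≤ 1 := by
  have hg2 : MemLp g 2 (gaussian n) :=
    MemLp.of_bound hg.aestronglyMeasurable 1 (Filter.Eventually.of_forall hg1)
  set F := Finset.univ.filter fun S : Finset (Fin n) =>
      τ < |∫ x, parity S x * g x ∂gaussian n| with hF
  calc (F.card : ℝ) * τ ^ 2 = ∑ S ∈ F, τ ^ 2 := by simp
    _ ≤ ∑ S ∈ F, (∫ x, parity S x * g x ∂gaussian n) ^ 2 := by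
      refine Finset.sum_le_sum fun S hS => ?_
      rw [← sq_abs (∫ x, parity S x * g x ∂gaussian n)]
      exact pow_le_pow_left₀ hτ.le (Finset.mem_filter.1 hS).2.le 2
    _ ≤ ∫ x, g x ^ 2 ∂gaussian n :=
      sum_sq_integral_mul_le F memLp_two_parity hg2 integral_parity_mul_parity
    _ ≤ ∫ _, (1 : ℝ) ∂gaussian n := by
      refine integral_mono hg2.integrable_sq (integrable_const _) fun x => ?_
      simpa using (sq_le_one_iff_abs_le_one _).2 (hg1 x)
    _ = 1 := by simp

/-! ### Labeled distributions -/

/-- The distribution of `(x, y x)` for Gaussian `x`. -/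
def labeled (y : (Fin n → ℝ) → ℝ) : Measure ((Fin n → ℝ) × ℝ) :=
  (gaussian n).map fun x => (x, y x)

/-- Gaussian points labeled by independent uniform signs. -/
def randomLabeled (n : ℕ) : Measure ((Fin n → ℝ) × ℝ) :=
  (2⁻¹ : ENNReal) • labeled (fun _ => 1) + (2⁻¹ : ENNReal) • labeled (fun _ => -1)

lemma measurable_prodMk_label {y : (Fin n → ℝ) → ℝ} (hy : Measurable y) :
    Measurable fun x => (x, y x) := measurable_id.prodMk hy

lemma map_fst_labeled {y : (Fin n → ℝ) → ℝ} (hy : Measurable y) :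
    (labeled y).map Prod.fst = gaussian n := by
  unfold labeled
  rw [Measure.map_map measurable_fst (measurable_prodMk_label hy)]
  exact Measure.map_id

lemma ae_labeled {y : (Fin n → ℝ) → ℝ} (hy : Measurable y) {B : ℝ} (hB : ∀ x, |y x| ≤ B) :
    ∀ᵐ p ∂labeled y, |p.2| ≤ B := by
  unfold labeled
  rw [ae_map_iff (measurable_prodMk_label hy).aemeasurable
    (measurableSet_le measurable_snd.abs measurable_const)]
  exact Filter.Eventually.of_forall hB

lemma isLabeledDistribution_labeled {y : (Fin n → ℝ) → ℝ} (hy : Measurable y) {B : ℝ}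
    (hB : ∀ x, |y x| ≤ B) : IsLabeledDistribution B (labeled y) :=
  ⟨map_fst_labeled hy, ae_labeled hy hB⟩

lemma isLabeledDistribution_randomLabeled {B : ℝ} (hB : 1 ≤ B) :
    IsLabeledDistribution B (randomLabeled n) := by
  constructor
  · unfold randomLabeled
    rw [Measure.map_add _ _ measurable_fst, Measure.map_smul, Measure.map_smul,
      map_fst_labeled measurable_const, map_fst_labeled measurable_const, ← add_smul,
      ENNReal.inv_two_add_inv_two, one_smul]
  · unfold randomLabeled
    rw [ae_add_measure_iff]
    exact ⟨Measure.ae_smul_measure (ae_labeled measurable_const fun x => by simpa using hB) _,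
      Measure.ae_smul_measure (ae_labeled measurable_const fun x => by simpa using hB) _⟩

lemma integral_labeled {y : (Fin n → ℝ) → ℝ} (hy : Measurable y) {φ : (Fin n → ℝ) × ℝ → ℝ}
    (hφ : AEStronglyMeasurable φ (labeled y)) :
    ∫ p, φ p ∂labeled y = ∫ x, φ (x, y x) ∂gaussian n :=
  integral_map (measurable_prodMk_label hy).aemeasurable hφ

lemma integral_fst_mul_snd_labeled {y : (Fin n → ℝ) → ℝ} (hy : Measurable y)
    {f : (Fin n → ℝ) → ℝ} (hf : AEStronglyMeasurable f (gaussian n)) :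
    ∫ p, f p.1 * p.2 ∂labeled y = ∫ x, f x * y x ∂gaussian n := by
  refine integral_labeled hy (AEStronglyMeasurable.mul ?_ measurable_snd.aestronglyMeasurable)
  refine AEStronglyMeasurable.comp_measurable ?_ measurable_fst
  rwa [map_fst_labeled hy]

/-! ### Queries on labels `±1` -/

namespace StatQuery

variable (φ : StatQuery n)

lemma abs_le (p : (Fin n → ℝ) × ℝ) : |φ.toFun p| ≤ 1 := _root_.abs_le.2 (φ.bounded p)

/-- The part of the query, restricted to labels `±1`, that ignores the label. -/
def evenPart (x : Fin n → ℝ) : ℝ := (φ.toFun (x, 1) + φ.toFun (x, -1)) / 2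

/-- The coefficient of the label in the query restricted to labels `±1`. -/
def oddPart (x : Fin n → ℝ) : ℝ := (φ.toFun (x, 1) - φ.toFun (x, -1)) / 2

lemma measurable_section (b : ℝ) : Measurable fun x => φ.toFun (x, b) :=
  φ.measurable.comp (measurable_id.prodMk measurable_const)

lemma measurable_evenPart : Measurable φ.evenPart :=
  ((φ.measurable_section 1).add (φ.measurable_section (-1))).div_const 2

lemma measurable_oddPart : Measurable φ.oddPart :=
  ((φ.measurable_section 1).sub (φ.measurable_section (-1))).div_const 2

lemma abs_evenPart_le (x : Fin n → ℝ) : |φ.evenPart x| ≤ 1 := by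
  have h1 := φ.bounded (x, 1)
  have h2 := φ.bounded (x, -1)
  unfold evenPart
  exact _root_.abs_le.2 ⟨by linarith [h1.1, h2.1], by linarith [h1.2, h2.2]⟩

lemma abs_oddPart_le (x : Fin n → ℝ) : |φ.oddPart x| ≤ 1 := by
  have h1 := φ.bounded (x, 1)
  have h2 := φ.bounded (x, -1)
  unfold oddPart
  exact _root_.abs_le.2 ⟨by linarith [h1.1, h2.2], by linarith [h1.2, h2.1]⟩

lemma apply_eq_evenPart_add (x : Fin n → ℝ) {b : ℝ} (hb : b = 1 ∨ b = -1) :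
    φ.toFun (x, b) = φ.evenPart x + b * φ.oddPart x := by
  unfold evenPart oddPart
  rcases hb with rfl | rfl <;> ring

lemma integral_labeled_of_sign {y : (Fin n → ℝ) → ℝ} (hy : Measurable y)
    (hy1 : ∀ x, y x = 1 ∨ y x = -1) :
    ∫ p, φ.toFun p ∂labeled y =
      ∫ x, φ.evenPart x ∂gaussian n + ∫ x, y x * φ.oddPart x ∂gaussian n := by
  rw [integral_labeled hy φ.measurable.aestronglyMeasurable, ← integral_add]
  · exact integral_congr_ae
      (Filter.Eventually.of_forall fun x => φ.apply_eq_evenPart_add x (hy1 x))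
  · exact Integrable.of_bound φ.measurable_evenPart.aestronglyMeasurable 1
      (Filter.Eventually.of_forall φ.abs_evenPart_le)
  · refine Integrable.of_bound (hy.mul φ.measurable_oddPart).aestronglyMeasurable 1
      (Filter.Eventually.of_forall fun x => ?_)
    rw [Real.norm_eq_abs, abs_mul]
    have : |y x| = 1 := by rcases hy1 x with h | h <;> rw [h] <;> norm_num
    rw [this, one_mul]
    exact φ.abs_oddPart_le x

/-- The odd part enters with opposite signs in the two halves of the mixture and cancels. -/
lemma integral_randomLabeled :
    ∫ p, φ.toFun p ∂randomLabeled n = ∫ x, φ.evenPart x ∂gaussian n := by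
  have hint : ∀ b : ℝ, Integrable φ.toFun (labeled (n := n) fun _ => b) := fun b => by
    have : IsProbabilityMeasure (labeled (n := n) fun _ => b) :=
      Measure.isProbabilityMeasure_map (measurable_id.prodMk measurable_const).aemeasurable
    exact Integrable.of_bound φ.measurable.aestronglyMeasurable 1
      (Filter.Eventually.of_forall φ.abs_le)
  unfold randomLabeled
  rw [integral_add_measure ((hint 1).smul_measure (by simp)) ((hint (-1)).smul_measure (by simp)),
    integral_smul_measure, integral_smul_measure,
    φ.integral_labeled_of_sign measurable_const (fun _ => Or.inl rfl),
    φ.integral_labeled_of_sign measurable_const (fun _ => Or.inr rfl)]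
  simp only [neg_mul, one_mul, integral_neg, ENNReal.toReal_inv, ENNReal.toReal_ofNat, smul_eq_mul]
  ring

end StatQuery

/-! ### The oracle adversary and the query bound -/

/-- Answering every query as for uniformly random labels, `A` makes some number `k` of queries, and
its run is also admissible for the labels `± parity S`, for all but at most `k / τ ^ 2` sets `S`. -/
lemma exists_run_forall_notMem {τ : ℝ} (hτ : 0 < τ) (A : Algorithm n) :
    ∃ (k : ℕ) (f : (Fin n → ℝ) → ℝ) (F : Finset (Finset (Fin n))),
      (F.card : ℝ) * τ ^ 2 ≤ k ∧ Run (randomLabeled n) τ A k f ∧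
        ∀ S ∉ F, Run (labeled (parity S)) τ A k f ∧
          Run (labeled fun x => -parity S x) τ A k f := by
  induction A with
  | output f =>
    exact ⟨0, f, ∅, by simp, .output f, fun S _ => ⟨.output f, .output f⟩⟩
  | ask φ next ih =>
    -- The answer is the exact mean under random labels; under `± parity S` it is off by the
    -- correlation of `parity S` with the odd part.
    obtain ⟨k, f, F, hF, h0, hrun⟩ := ih (∫ x, φ.evenPart x ∂gaussian n)
    have hbad := card_correlated_parity_mul_sq_le φ.measurable_oddPart φ.abs_oddPart_le hτ
    set E := Finset.univ.filter fun S : Finset (Fin n) =>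
      τ < |∫ x, parity S x * φ.oddPart x ∂gaussian n| with hE
    refine ⟨k + 1, f, F ∪ E, ?_, ?_, fun S hS => ?_⟩
    · have hcard : ((F ∪ E).card : ℝ) ≤ F.card + E.card := by
        exact_mod_cast Finset.card_union_le F E
      push_cast
      nlinarith [sq_nonneg τ]
    · refine .ask φ next _ k f ?_ h0
      rw [φ.integral_randomLabeled, sub_self, abs_zero]
      exact hτ.le
    · rw [Finset.mem_union, not_or] at hS
      have hcorr : |∫ x, parity S x * φ.oddPart x ∂gaussian n| ≤ τ := by
        simpa [hE] using hS.2
      refine ⟨.ask φ next _ k f ?_ (hrun S hS.1).1, .ask φ next _ k f ?_ (hrun S hS.1).2⟩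
      · rw [φ.integral_labeled_of_sign (measurable_parity S) (parity_eq_one_or S)]
        simpa using hcorr
      · rw [φ.integral_labeled_of_sign (measurable_neg_parity S) fun x => ?_]
        · simpa [integral_neg] using hcorr
        · rcases parity_eq_one_or S x with h | h <;> simp [h]

/-- No function is a good hypothesis both for the labels `parity S` and for their negatives. -/
lemma pow_card_le_two_mul_error {d : ℕ} {S : Finset (Fin n)} (hS : S.Nonempty) (hd : S.card ≤ d)
    {f : (Fin n → ℝ) → ℝ} (hf : MemLp f 2 (gaussian n)) {ε : ℝ}
    (hpos : ∀ h ∈ monomials n d, ∫ p, h p.1 * p.2 ∂labeled (parity S) - ε ≤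
      ∫ p, f p.1 * p.2 ∂labeled (parity S))
    (hneg : ∀ h ∈ monomials n d, ∫ p, h p.1 * p.2 ∂labeled (fun x => -parity S x) - ε ≤
      ∫ p, f p.1 * p.2 ∂labeled (fun x => -parity S x)) :
    (∫ t, |t| ∂gaussianReal 0 1) ^ S.card ≤ 2 * ε := by
  have h1 := hpos _ ⟨S, hd, rfl⟩
  -- The empty monomial is the constant `1`, uncorrelated with a nonempty parity.
  have h2 := hneg _ ⟨∅, by simp, rfl⟩
  have hm : Measurable fun x : Fin n → ℝ => ∏ i ∈ S, x i :=
    Finset.measurable_prod _ fun i _ => measurable_pi_apply i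
  rw [integral_fst_mul_snd_labeled (measurable_parity S) hm.aestronglyMeasurable,
    integral_fst_mul_snd_labeled (measurable_parity S) hf.1, integral_monomial_mul_parity] at h1
  rw [integral_fst_mul_snd_labeled (measurable_neg_parity S) (by fun_prop),
    integral_fst_mul_snd_labeled (measurable_neg_parity S) hf.1] at h2
  simp only [Finset.prod_empty, one_mul, mul_neg, integral_neg, integral_parity_eq_zero hS] at h2
  linarith

/-- A learner with error below half the correlation of a monomial with its sign needs at least
`n.choose d * τ ^ 2` queries. -/
theorem choose_mul_sq_le_of_agnosticallyLearns {d : ℕ} (hd : 1 ≤ d) {R B ε τ : ℝ} (hB : 1 ≤ B)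
    (hε : 2 * ε < (∫ t, |t| ∂gaussianReal 0 1) ^ d) (hτ : 0 < τ) {A : Algorithm n} {q : ℕ}
    (hA : AgnosticallyLearns A (monomials n d) R B ε τ q) :
    (n.choose d : ℝ) * τ ^ 2 ≤ q := by
  obtain ⟨k, f, F, hF, h0, hrun⟩ := exists_run_forall_notMem hτ A
  -- Random labels are themselves an allowed distribution, so `k` is bounded even if no `S`
  -- survives.
  have hkq : (k : ℝ) ≤ q := by
    exact_mod_cast (hA _ (isLabeledDistribution_randomLabeled hB) k f h0).1
  have hsub : Finset.powersetCard d Finset.univ ⊆ F := by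
    intro S hS
    by_contra hSF
    have hcard : S.card = d := (Finset.mem_powersetCard.1 hS).2
    have hpos := hA _ (isLabeledDistribution_labeled (measurable_parity S)
      fun x => (abs_parity S x).trans_le hB) k f (hrun S hSF).1
    have hneg := hA _ (isLabeledDistribution_labeled (measurable_neg_parity S)
      fun x => by rw [abs_neg, abs_parity]; exact hB) k f (hrun S hSF).2
    have h := pow_card_le_two_mul_error (Finset.card_pos.1 (by omega)) hcard.le hpos.2.1
      hpos.2.2.2 hneg.2.2.2
    rw [hcard] at h
    linarith
  have hle : (n.choose d : ℝ) ≤ F.card := by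
    have := Finset.card_le_card hsub
    rw [Finset.card_powersetCard, Finset.card_univ, Fintype.card_fin] at this
    exact_mod_cast this
  exact (mul_le_mul_of_nonneg_right hle (sq_nonneg τ)).trans (hF.trans hkq)

end SQ

/-! ### Binomial estimates and the final bound -/

lemma div_pow_le_choose {n d : ℕ} (hdn : d ≤ n) :
    ((n : ℝ) / d) ^ d ≤ n.choose d := by
  induction d generalizing n with
  | zero => simp
  | succ d ih =>
    obtain ⟨n, rfl⟩ : ∃ m, n = m + 1 := ⟨n - 1, by omega⟩
    have hdn' : d ≤ n := by omega
    have hrec : ((n + 1).choose (d + 1) : ℝ) = ((n : ℝ) + 1) / (d + 1) * n.choose d := by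
      have h : ((n : ℝ) + 1) * n.choose d = (n + 1).choose (d + 1) * (d + 1) := by
        exact_mod_cast Nat.add_one_mul_choose_eq n d
      field_simp
      linarith
    have hpow : (((n : ℝ) + 1) / (d + 1)) ^ d ≤ ((n : ℝ) / d) ^ d := by
      rcases Nat.eq_zero_or_pos d with rfl | hd
      · simp
      · have hd' : (0 : ℝ) < d := by exact_mod_cast hd
        have hle : (d : ℝ) ≤ n := by exact_mod_cast hdn'
        refine pow_le_pow_left₀ (by positivity) ?_ d
        rw [div_le_div_iff₀ (by positivity) hd']
        nlinarith
    push_cast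
    rw [hrec, pow_succ']
    exact mul_le_mul_of_nonneg_left (hpow.trans (ih hdn')) (by positivity)

lemma rpow_mul_le_choose {n d : ℕ} (hd : 1 ≤ d) (hdn : d ≤ n) {δ : ℝ}
    (h : (d : ℝ) ≤ (n : ℝ) ^ (1 - δ)) : (n : ℝ) ^ (δ * d) ≤ n.choose d := by
  have hd' : (0 : ℝ) < d := by exact_mod_cast hd
  have hn : (0 : ℝ) < n := by exact_mod_cast hd.trans hdn
  refine le_trans ?_ (div_pow_le_choose hdn)
  rw [Real.rpow_mul hn.le, Real.rpow_natCast]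
  refine pow_le_pow_left₀ (by positivity) ?_ d
  rw [le_div_iff₀ hd']
  calc (n : ℝ) ^ δ * d ≤ (n : ℝ) ^ δ * (n : ℝ) ^ (1 - δ) := by gcongr
    _ = n := by rw [← Real.rpow_add hn]; simp

end

theorem mainTheorem6 :
    ∃ C : ℝ, 0 < C ∧ ∀ n d : ℕ, 1 ≤ d → d ≤ n →
      ∀ ε τ B : ℝ, 0 < ε → ε ≤ Real.exp (-(C * d)) → 0 < τ → τ ≤ ε ^ 2 → 1 ≤ B →
        ∀ (A : SQ.Algorithm n) (q : ℕ),
          SQ.AgnosticallyLearns A (SQ.monomials n d) 1 B ε τ q →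
            (n.choose d : ℝ) * τ ^ (5 / 2 : ℝ) ≤ q ∧
            ∀ δ : ℝ, 0 < δ → (d : ℝ) ≤ (n : ℝ) ^ (1 - δ) →
              (n : ℝ) ^ (δ * d) * τ ^ (5 / 2 : ℝ) ≤ q := by
  set m : ℝ := ∫ t, |t| ∂ProbabilityTheory.gaussianReal 0 1 with hm
  have hm0 : 0 < m := SQ.integral_abs_gaussianReal_pos
  -- The second entry gives `exp (-C) < m / 2`, strict thanks to its summand `1`; the first keeps
  -- `C` positive.
  refine ⟨max 1 (1 - Real.log (m / 2)), by positivity, ?_⟩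
  intro n d hd hdn ε τ B hε hεC hτ hτε hB A q hA
  have hexp : Real.exp (-max 1 (1 - Real.log (m / 2))) < m / 2 := by
    rw [← Real.lt_log_iff_exp_lt (by positivity)]
    linarith [le_max_right 1 (1 - Real.log (m / 2))]
  have hε2 : 2 * ε < m ^ d := by
    have h1 : ε ≤ Real.exp (-max 1 (1 - Real.log (m / 2))) ^ d := by
      rw [← Real.exp_nat_mul]
      convert hεC using 2
      ring
    have h2 : Real.exp (-max 1 (1 - Real.log (m / 2))) ^ d < (m / 2) ^ d :=
      pow_lt_pow_left₀ hexp (Real.exp_pos _).le (by omega)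
    -- The `2` in `m / 2` absorbs the factor of `2 * ε`, since `d ≥ 1`.
    have h3 : (m / 2) ^ d ≤ m ^ d / 2 := by
      rw [div_pow]
      have : (2 : ℝ) ≤ 2 ^ d := le_self_pow₀ one_le_two (by omega)
      gcongr
    linarith
  have hε1 : ε ≤ 1 := hεC.trans (Real.exp_le_one_iff.2 (by
    have : 0 ≤ max 1 (1 - Real.log (m / 2)) * d := by positivity
    linarith))
  have hτ1 : τ ≤ 1 := hτε.trans (pow_le_one₀ hε.le hε1)
  have hτpow : τ ^ (5 / 2 : ℝ) ≤ τ ^ 2 := by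
    rw [← Real.rpow_natCast τ 2]
    exact Real.rpow_le_rpow_of_exponent_ge hτ hτ1 (by norm_num)
  have hmain : (n.choose d : ℝ) * τ ^ (5 / 2 : ℝ) ≤ q :=
    (mul_le_mul_of_nonneg_left hτpow (Nat.cast_nonneg _)).trans
      (SQ.choose_mul_sq_le_of_agnosticallyLearns hd hB hε2 hτ hA)
  refine ⟨hmain, fun δ _ hδ => le_trans ?_ hmain⟩
  exact mul_le_mul_of_nonneg_right (rpow_mul_le_choose hd hdn hδ) (by positivity)
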